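/- A regular $n$-chain ($n\ge 0$) is a tuple $\underline A=(A,\mathfrak p_n,\dots,\mathfrak p_0)$, where $A$ is an $n$-dimensional Noetherian regular local ring and $\mathfrak p_0\subsetneq\mathfrak p_1\subsetneq\dots\subsetneq\mathfrak p_n$ are prime ideals of $A$ such that each $A/\mathfrak p_i$ is a regular local ring (so $\mathfrak p_n$ is the maximal ideal and $\mathfrak p_0=0$). Put $$\operatorname{comp}\underline A=(\widehat A,\mathfrak p_n\widehat A,\dots,\mathfrak p_0\widehat A),\qquad \operatorname{loc}\underline A=(A_{\mathfrak p_{n-1}},\mathfrak p_{n-1}A_{\mathfrak p_{n-1}},\dots,\mathfrak p_0A_{\mathfrak p_{n-1}})\quad(n\ge1),$$ where $\widehat A$ is the $\mathfrak p_n$-adic completion of $A$; these are regular chains of length $n$ and $n-1$. Let $HL(\underline A)$ be the ring of the chain of length $0$ obtained from $\underline A$ by applying $\operatorname{loc}\circ\operatorname{comp}$ $n$ times; there is a natural ring homomorphism $A\to HL(\underline A)$. For $0\le i\le n$ let $\tau_i\underline A=(A/\mathfrak p_i,\mathfrak p_n/\mathfrak p_i,\dots,\mathfrak p_i/\mathfrak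 p_i)$, a regular $(n-i)$-chain. A complete discrete valuation field is a field $F$ that is complete for some surjective discrete valuation; this valuation is unique, and its residue field is denoted $\overline F$. Put $F^{(0)}=F$ and, as long as $F^{(j)}$ is a complete discrete valuation field, $F^{(j+1)}=\overline{F^{(j)}}$. Proposition. Let $\underline A$ be a regular $n$-chain and $0\le i\le n$. Then $F=HL(\underline A)$ is a field, $F^{(0)},\dots,F^{(i-1)}$ are complete discrete valuation fields (so that the $i$-th residue field $F^{(i)}$ exists), and $F^{(i)}=HL(\tau_i\underline A)$. Here equality means that the natural map $A\to F$ induces successively maps $A\to\mathcal O_{F^{(j)}}\to F^{(j+1)}$ for $0\le j<i$, and that there is an isomorphism of fields $F^{(i)}\cong HL(\tau_i\underline A)$ that is compatible with the resulting map $A\to F^{(i)}$ and with the natural map $A\to A/\mathfrak p_i\to HL(\tau_i\underline A)$. -/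

import Mathlib

open scoped WithZero

universe u

/-! ### Iterated residue fields of complete discrete valuation fields -/

/-- `v` is a (normalised, i.e. surjective) discrete valuation on the field `F`, written
multiplicatively, and `F` is complete in the topology defined by `v`. -/
structure IsCompleteDiscreteValuation {F : Type u} [CommRing F] (v : Valuation F ℤᵐ⁰) : Prop where
  isField : IsField F
  surjective : Function.Surjective v
  complete : @CompleteSpace F (Valued.mk' v).toUniformSpace

/-- The residue ring `{v ≤ 1} / {v < 1}` of a valuation. -/
abbrev ValuationResidue {F : Type u} [CommRing F] (v : Valuation F ℤᵐ⁰) : Type u :=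
  v.integer ⧸ v.ltIdeal 1

/-- Let `f : R → F` and `g : R → K` be ring homomorphisms. `IsResidueField g i f` says that `F` is a
field, that its successive residue fields `F = F⁽⁰⁾, F⁽¹⁾, …, F⁽ⁱ⁾` exist (so `F⁽ʲ⁾` is a complete
discrete valuation field with residue field `F⁽ʲ⁺¹⁾` for every `j < i`), that `f` lands in the ring
of integers of `F` and induces `R → F⁽¹⁾`, which again lands in the ring of integers of `F⁽¹⁾`, and
so on, and that the resulting `R → F⁽ⁱ⁾` is identified with `g` by a ring isomorphism `F⁽ⁱ⁾ ≃ K`.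

The surjective discrete valuation under which a field is complete is unique, so the existential
quantifier over `v` makes no choice. -/
def IsResidueField {R K : Type u} [CommRing R] [CommRing K] (g : R →+* K) :
    ∀ (_ : ℕ) {F : Type u} [CommRing F] (_ : R →+* F), Prop
  | 0, F, _, f => IsField F ∧ ∃ e : F ≃+* K, ∀ r, e (f r) = g r
  | i + 1, F, _, f => ∃ v : Valuation F ℤᵐ⁰, IsCompleteDiscreteValuation v ∧
      ∃ h : ∀ r, f r ∈ v.integer,
        IsResidueField g i (F := ValuationResidue v)
          ((Ideal.Quotient.mk (v.ltIdeal 1)).comp (f.codRestrict v.integer h))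

/-! ### Chains -/

/-- A commutative ring together with ideals `𝔭₀, …, 𝔭ₙ`. -/
structure IdealChain (n : ℕ) : Type (u + 1) where
  ring : Type u
  [commRing : CommRing ring]
  ideal : Fin (n + 1) → Ideal ring

attribute [instance] IdealChain.commRing

namespace IdealChain

variable {n : ℕ}

/-- Regular `n`-chains `(A, 𝔭ₙ, …, 𝔭₀)`. -/
structure IsRegular (A : IdealChain.{u} n) : Prop where
  regular : IsRegularLocalRing A.ring
  dim : ringKrullDim A.ring = n
  prime : ∀ i, (A.ideal i).IsPrime
  regular_quotient : ∀ i, IsRegularLocalRing (A.ring ⧸ A.ideal i)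
  strictMono : StrictMono A.ideal

/-- Completion: `(Â, 𝔭ₙÂ, …, 𝔭₀Â)`, where `Â` is the `𝔭ₙ`-adic completion of `A`. -/
noncomputable def comp (A : IdealChain.{u} n) : IdealChain.{u} n where
  ring := AdicCompletion (A.ideal (Fin.last n)) A.ring
  ideal i := (A.ideal i).map (algebraMap A.ring (AdicCompletion (A.ideal (Fin.last n)) A.ring))

/-- The multiplicative set generated by the complement of an ideal. If the ideal is prime, then this
is the complement itself, see `complMonoid_eq_primeCompl`. -/
def complMonoid {R : Type u} [CommRing R] (p : Ideal R) : Submonoid R :=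
  Submonoid.closure (p : Set R)ᶜ

theorem complMonoid_eq_primeCompl {R : Type u} [CommRing R] (p : Ideal R) [p.IsPrime] :
    complMonoid p = p.primeCompl :=
  Submonoid.closure_eq p.primeCompl

/-- Localisation away from `𝔭 = 𝔭ₙ` of a chain of length `n + 1`:
`(A_𝔭, 𝔭ₙ A_𝔭, …, 𝔭₀ A_𝔭)`, a chain of length `n`. -/
noncomputable def loc (A : IdealChain.{u} (n + 1)) : IdealChain.{u} n where
  ring := Localization (complMonoid (A.ideal (Fin.last n).castSucc))
  ideal i := (A.ideal i.castSucc).map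
    (algebraMap A.ring (Localization (complMonoid (A.ideal (Fin.last n).castSucc))))

/-- Truncation: `τᵢ A = (A/𝔭ᵢ, 𝔭ₙ/𝔭ᵢ, …, 𝔭ᵢ/𝔭ᵢ)`, a chain of length `m = n - i`. -/
def trunc (A : IdealChain.{u} n) (i m : ℕ) (h : i + m = n) : IdealChain.{u} m where
  ring := A.ring ⧸ A.ideal ⟨i, by omega⟩
  ideal j := (A.ideal ⟨i + j, by omega⟩).map (Ideal.Quotient.mk _)

/-- The projection `A → A/𝔭ᵢ` onto the ring of `τᵢ A`. -/
def toTrunc (A : IdealChain.{u} n) (i m : ℕ) (h : i + m = n) : A.ring →+* (A.trunc i m h).ring :=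
  Ideal.Quotient.mk (A.ideal ⟨i, by omega⟩)

/-- The natural map from the ring of `A` to the ring of `loc (comp A)`. -/
noncomputable def toLocComp (A : IdealChain.{u} (n + 1)) : A.ring →+* A.comp.loc.ring :=
  (algebraMap A.comp.ring
    (Localization (complMonoid (A.comp.ideal (Fin.last n).castSucc)))).comp
    (algebraMap A.ring (AdicCompletion (A.ideal (Fin.last (n + 1))) A.ring))

/-- `HL(A) = loc comp ⋯ loc comp A`, with `loc comp` applied `n` times; a chain of length `0`, which
is identified with its ring `A.HL.ring`. -/
noncomputable def HL : ∀ {n : ℕ}, IdealChain.{u} n → IdealChain.{u} 0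
  | 0, A => A
  | _ + 1, A => HL A.comp.loc

/-- The natural map `A → HL(A)`. -/
noncomputable def toHL : ∀ {n : ℕ} (A : IdealChain.{u} n), A.ring →+* A.HL.ring
  | 0, A => RingHom.id A.ring
  | _ + 1, A => (toHL A.comp.loc).comp A.toLocComp

end IdealChain

/-! Regularity is used only to extract a weaker property, `IsPrincipal`: the ring is Noetherian, `𝔭₀
= 0`, `𝔭ₙ` is maximal, and each prime `𝔭ᵢ₊₁` is `𝔭ᵢ` plus one element outside `𝔭ᵢ`. A regular chain
has it because `dim A/𝔭ᵢ = n - i`, and a regular quotient of dimension one less is cut out by one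
element (`IsRegularLocalRing.exists_eq_span_singleton`).

This property survives completion, localisation and truncation. Completion is the hard case: that
`𝔭ᵢÂ` stays prime follows by descending induction on `i` from
`AdicCompletion.isPrime_map_of_isPrime_map_sup`.

Truncation commutes with `comp` (exactness of completion on finite modules) and with `loc`. Hence
the case `i = 1` reduces to a chain of length 1, where `Â` is a complete discrete valuation ring
with residue field `A/𝔭₁` and `HL(A)` is its fraction field (`IsTrunc.exists_residue`). Since `τᵢ₊₁
A = τᵢ(τ₁ A)`, induction on `i` gives the general case. -/

section RegularLocal

/-! ### Regular local rings: embedding dimension, integrality, principal primes. -/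

open IsLocalRing

/-- The class of `x` in `𝔪/𝔪²` is nonzero, so it extends to a basis. By Nakayama, lifts of the basis
generate `𝔪`, and the lift of that class dies modulo `x`. -/
theorem IsLocalRing.spanFinrank_maximalIdeal_quotient_add_one_le {R : Type*} [CommRing R]
    [IsLocalRing R] [IsNoetherianRing R] {x : R} (hx : x ∈ maximalIdeal R)
    (hx2 : x ∉ maximalIdeal R ^ 2) [IsLocalRing (R ⧸ Ideal.span {x})] :
    (maximalIdeal (R ⧸ Ideal.span {x})).spanFinrank + 1 ≤ (maximalIdeal R).spanFinrank := by
  classical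
  set q := (maximalIdeal R).toCotangent
  set v : CotangentSpace R := q ⟨x, hx⟩ with hv
  have hv0 : v ≠ 0 := fun h ↦ hx2 (((maximalIdeal R).toCotangent_eq_zero ⟨x, hx⟩).1 h)
  have hli : LinearIndepOn (ResidueField R) id {v} := LinearIndepOn.singleton (by simpa using hv0)
  set s := hli.extend (Set.subset_univ _)
  have hvs : v ∈ s := hli.subset_extend _ rfl
  have hsfin : s.Finite := Module.Finite.finite_basis (Module.Basis.extend hli)
  have hcard : s.ncard = (maximalIdeal R).spanFinrank := by
    rw [spanFinrank_maximalIdeal_eq_finrank_cotangentSpace,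
      Module.finrank_eq_nat_card_basis (Module.Basis.extend hli)]
    rfl
  have hspan : Submodule.span (ResidueField R) s = ⊤ := by
    rw [← (Module.Basis.extend hli).span_eq, Module.Basis.range_extend]
  obtain ⟨g, hg⟩ := (maximalIdeal R).toCotangent_surjective.hasRightInverse
  -- The section is modified so that the class of `x` lifts to `x` itself.
  let g' : CotangentSpace R → maximalIdeal R := fun w ↦ if w = v then ⟨x, hx⟩ else g w
  have hg' : ∀ w, q (g' w) = w := by
    intro w
    by_cases hw : w = v
    · rw [hw]; simp only [g', if_true]; rfl
    · simp only [g', if_neg hw]; exact hg w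
  have himg : q '' (g' '' s) = s := by
    rw [← Set.image_comp]
    exact (Set.image_congr fun w _ ↦ hg' w).trans (Set.image_id _)
  have htop : Submodule.span R (g' '' s) = ⊤ := by
    rw [← CotangentSpace.span_image_eq_top_iff, himg, hspan]
  have hm : maximalIdeal R = Ideal.span ((fun w ↦ (g' w : R)) '' s) := by
    have := congrArg (Submodule.map (maximalIdeal R).subtype) htop
    rw [Submodule.map_span, Submodule.map_top, Submodule.range_subtype, ← Set.image_comp] at this
    exact this.symm
  set π := Ideal.Quotient.mk (Ideal.span {x})
  have hm' : maximalIdeal (R ⧸ Ideal.span {x}) =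
      Ideal.span ((fun w ↦ π (g' w)) '' (s \ {v})) := by
    refine (map_maximalIdeal_of_surjective π Ideal.Quotient.mk_surjective).symm.trans ?_
    refine (congrArg (Ideal.map π) hm).trans ?_
    rw [Ideal.map_span,
      ← Set.image_comp, ← Set.insert_sdiff_self_of_mem hvs, Set.image_insert_eq]
    have : (π ∘ fun w ↦ (g' w : R)) v = 0 := by
      simp [g', π]
    rw [this, Ideal.span_insert_zero, Set.insert_sdiff_self_of_mem hvs]
    rfl
  rw [hm', ← hcard, ← Set.ncard_sdiff_singleton_add_one hvs hsfin]
  have h1 := Submodule.spanFinrank_span_le_ncard_of_finite (R := R ⧸ Ideal.span {x})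
    ((hsfin.sdiff (t := {v})).image (fun w ↦ π (g' w)))
  exact Nat.succ_le_succ (h1.trans (Set.ncard_image_le hsfin.sdiff))

/-- Lifts of generators of `𝔪/p` generate `𝔪` modulo `p ≤ 𝔪²`, hence generate `𝔪` by Nakayama. -/
theorem IsLocalRing.spanFinrank_maximalIdeal_le_of_le_sq {R : Type*} [CommRing R]
    [IsLocalRing R] [IsNoetherianRing R] {p : Ideal R} (hp : p ≤ maximalIdeal R ^ 2)
    [IsLocalRing (R ⧸ p)] :
    (maximalIdeal R).spanFinrank ≤ (maximalIdeal (R ⧸ p)).spanFinrank := by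
  classical
  obtain ⟨s, hs, hspan⟩ := Submodule.FG.exists_span_finset_card_eq_spanFinrank
    (maximalIdeal (R ⧸ p)).fg_of_isNoetherianRing
  obtain ⟨g, hg⟩ := (Ideal.Quotient.mk_surjective (I := p)).hasRightInverse
  have hmap := map_maximalIdeal_of_surjective _ (Ideal.Quotient.mk_surjective (I := p))
  have hpm : p ≤ maximalIdeal R := hp.trans (Ideal.pow_le_self two_ne_zero)
  have hmap2 : (Ideal.span (g '' s)).map (Ideal.Quotient.mk p) = maximalIdeal (R ⧸ p) := by
    rw [Ideal.map_span, ← Set.image_comp, hg.comp_eq_id, Set.image_id]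
    exact hspan
  have hle : maximalIdeal R ≤ Ideal.span (g '' s) ⊔ p := by
    have := congrArg (Ideal.comap (Ideal.Quotient.mk p)) (hmap.trans hmap2.symm)
    rw [Ideal.comap_map_of_surjective' _ Ideal.Quotient.mk_surjective,
      Ideal.comap_map_of_surjective' _ Ideal.Quotient.mk_surjective, Ideal.mk_ker] at this
    exact le_sup_left.trans this.le
  have hle2 : Ideal.span (g '' s) ≤ maximalIdeal R := by
    have : Ideal.span (g '' s) ≤
        ((maximalIdeal R).map (Ideal.Quotient.mk p)).comap (Ideal.Quotient.mk p) := by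
      rw [← Ideal.map_le_iff_le_comap, hmap2]
      exact hmap.ge
    rwa [Ideal.comap_map_of_surjective' _ Ideal.Quotient.mk_surjective, Ideal.mk_ker,
      sup_eq_left.2 hpm] at this
  have hm : maximalIdeal R = Ideal.span (g '' s) := by
    refine le_antisymm ?_ hle2
    refine Submodule.le_of_le_smul_of_le_jacobson_bot (I := maximalIdeal R)
      (maximalIdeal R).fg_of_isNoetherianRing (maximalIdeal_le_jacobson _) ?_
    refine hle.trans (sup_le_sup_left ?_ _)
    rwa [smul_eq_mul, ← pow_two]
  rw [hm, ← hs]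
  refine (Submodule.spanFinrank_span_le_ncard_of_finite (s.finite_toSet.image g)).trans ?_
  exact (Set.ncard_image_le s.finite_toSet).trans (Set.ncard_coe_finset s).le

/-- A minimal prime `q` inside `(x)` does not contain `x`, so `q = xq`, and Nakayama gives `q = 0`.
-/
theorem IsLocalRing.isDomain_of_isPrime_span_singleton {R : Type*} [CommRing R] [IsLocalRing R]
    [IsNoetherianRing R] {x : R} (hx : x ∈ maximalIdeal R) (hprime : (Ideal.span {x}).IsPrime)
    (hmin : ∀ q ∈ minimalPrimes R, x ∉ q) : IsDomain R := by
  obtain ⟨q, hq, hqx⟩ := Ideal.exists_minimalPrimes_le (I := ⊥) (J := Ideal.span {x}) bot_le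
  have hqp : q.IsPrime := hq.1.1
  have : q = ⊥ := by
    refine Submodule.eq_bot_of_le_smul_of_le_jacobson_bot (Ideal.span {x}) q
      q.fg_of_isNoetherianRing (fun y hy ↦ ?_)
      (((Ideal.span_singleton_le_iff_mem _).2 hx).trans (maximalIdeal_le_jacobson _))
    obtain ⟨z, rfl⟩ := Ideal.mem_span_singleton'.1 (hqx hy)
    rw [mul_comm]
    exact Ideal.mul_mem_mul (Ideal.mem_span_singleton_self x)
      ((hqp.mem_or_mem hy).resolve_right (hmin q hq))
  subst this
  exact IsDomain.of_bot_isPrime R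

theorem isLocalRing_quotient_span_singleton {R : Type*} [CommRing R] [IsLocalRing R]
    {x : R} (hx : x ∈ maximalIdeal R) : IsLocalRing (R ⧸ Ideal.span {x}) := by
  have : Nontrivial (R ⧸ Ideal.span {x}) := Ideal.Quotient.nontrivial_iff.2 fun h ↦
    (maximalIdeal.isMaximal R).ne_top (top_le_iff.1 (h ▸ (Ideal.span_singleton_le_iff_mem _).2 hx))
  exact .of_surjective' _ Ideal.Quotient.mk_surjective

theorem ringKrullDim_le_quotient_span_singleton_add_one {R : Type*} [CommRing R] [IsLocalRing R]
    [IsNoetherianRing R] {x : R} (hx : x ∈ maximalIdeal R) :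
    ringKrullDim R ≤ ringKrullDim (R ⧸ Ideal.span {x}) + 1 := by
  have := ringKrullDim_le_ringKrullDim_quotient_add_card (R := R) {x}
    (by simpa [IsLocalRing.ringJacobson_eq_maximalIdeal] using hx)
  rwa [Finset.coe_singleton, Finset.card_singleton, Nat.cast_one] at this

/-- Dividing a regular local ring of dimension `d + 1` by an element of `𝔪 \ 𝔪²` gives a regular
local ring of dimension `d`. -/
theorem IsRegularLocalRing.quotient_span_singleton {R : Type*} [CommRing R] [IsRegularLocalRing R]
    {x : R} (hx : x ∈ maximalIdeal R) (hx2 : x ∉ maximalIdeal R ^ 2) {d : ℕ}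
    (hd : ringKrullDim R = (d + 1 : ℕ)) :
    IsRegularLocalRing (R ⧸ Ideal.span {x}) ∧ ringKrullDim (R ⧸ Ideal.span {x}) = d := by
  have := isLocalRing_quotient_span_singleton hx
  have h1 := IsLocalRing.spanFinrank_maximalIdeal_quotient_add_one_le hx hx2
  have h2 : (maximalIdeal R).spanFinrank = d + 1 := by
    have := IsRegularLocalRing.spanFinrank_maximalIdeal (R := R)
    rw [hd] at this
    exact_mod_cast this
  have h3 := ringKrullDim_le_quotient_span_singleton_add_one hx
  rw [hd] at h3
  have h4 : (d : WithBot ℕ∞) ≤ ringKrullDim (R ⧸ Ideal.span {x}) := by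
    rw [Nat.cast_add, Nat.cast_one] at h3
    exact (ENat.WithBot.add_le_add_one_right_iff).1 h3
  have h5 := ringKrullDim_le_spanFinrank_maximalIdeal (R ⧸ Ideal.span {x})
  have h6 : (maximalIdeal (R ⧸ Ideal.span {x})).spanFinrank ≤ d := by omega
  have h7 : ((maximalIdeal (R ⧸ Ideal.span {x})).spanFinrank : WithBot ℕ∞) ≤ d := by
    exact_mod_cast h6
  exact ⟨.of_spanFinrank_maximalIdeal_le _ (h7.trans h4), le_antisymm (h5.trans h7) h4⟩

/-- Prime avoidance gives `x ∈ 𝔪` outside `𝔪²` and outside all minimal primes. By induction `R/x` is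
a domain, so `(x)` is prime and the previous criterion applies. -/
theorem IsRegularLocalRing.isDomain_of_ringKrullDim_eq (d : ℕ) :
    ∀ {R : Type u} [CommRing R] [IsRegularLocalRing R], ringKrullDim R = d → IsDomain R := by
  induction d with
  | zero =>
    intro R _ _ hd
    have h := IsRegularLocalRing.spanFinrank_maximalIdeal (R := R)
    rw [hd] at h
    have h : (maximalIdeal R).spanFinrank = 0 := by exact_mod_cast h
    rw [Submodule.spanFinrank_eq_zero_iff_eq_bot (maximalIdeal R).fg_of_isNoetherianRing,
      ← isField_iff_maximalIdeal_eq] at h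
    exact h.isDomain
  | succ d ih =>
    intro R _ _ hd
    obtain ⟨x, hx, hx2, hmin⟩ : ∃ x ∈ maximalIdeal R, x ∉ maximalIdeal R ^ 2 ∧
        ∀ q ∈ minimalPrimes R, x ∉ q := by
      by_contra! hcon
      have hfin := minimalPrimes.finite_of_isNoetherianRing R
      have hsub : ((maximalIdeal R : Ideal R) : Set R) ⊆
          ⋃ i ∈ ((insert (maximalIdeal R ^ 2) hfin.toFinset : Finset (Ideal R)) :
            Set (Ideal R)), ((id i : Ideal R) : Set R) := by
        intro x hx
        by_cases hx2 : x ∈ maximalIdeal R ^ 2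
        · exact Set.mem_biUnion (x := maximalIdeal R ^ 2) (by simp) hx2
        · obtain ⟨q, hq, hxq⟩ := hcon x hx hx2
          exact Set.mem_biUnion (x := q) (by simp [hq]) hxq
      -- Prime avoidance allows two ideals that need not be prime; `𝔪²` fills both places. Either
      -- outcome, `𝔪 ≤ 𝔪²` or `𝔪` a minimal prime, forces dimension 0.
      rw [Ideal.subset_union_prime (maximalIdeal R ^ 2) (maximalIdeal R ^ 2)] at hsub
      · obtain ⟨i, hi, hle⟩ := hsub
        rw [Finset.mem_insert] at hi
        rcases hi with rfl | hi
        · have hbot : maximalIdeal R = ⊥ :=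
            Submodule.eq_bot_of_le_smul_of_le_jacobson_bot _ _
              (maximalIdeal R).fg_of_isNoetherianRing
              (by rwa [smul_eq_mul, ← pow_two]) (maximalIdeal_le_jacobson _)
          rw [← isField_iff_maximalIdeal_eq] at hbot
          rw [ringKrullDim_eq_zero_of_isField hbot] at hd
          exact absurd hd (by exact_mod_cast (Nat.succ_ne_zero d).symm)
        · rw [Set.Finite.mem_toFinset] at hi
          have him : i = maximalIdeal R :=
            le_antisymm (le_maximalIdeal hi.1.1.ne_top) hle
          subst him
          have : Ring.KrullDimLE 0 R := by
            rw [Ring.krullDimLE_zero_iff]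
            intro q hq
            have : q = maximalIdeal R := le_antisymm (le_maximalIdeal hq.ne_top)
              (hi.2 ⟨hq, bot_le⟩ (le_maximalIdeal hq.ne_top))
            exact this ▸ maximalIdeal.isMaximal R
          rw [ringKrullDimZero_iff_ringKrullDim_eq_zero, hd] at this
          exact absurd this (by exact_mod_cast (Nat.succ_ne_zero d))
      · intro i hi h1 _
        rw [Finset.mem_insert, or_iff_right h1, Set.Finite.mem_toFinset] at hi
        exact hi.1.1
    obtain ⟨hreg, hdim⟩ := IsRegularLocalRing.quotient_span_singleton hx hx2 hd
    have := ih hdim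
    exact IsLocalRing.isDomain_of_isPrime_span_singleton hx
      ((Ideal.Quotient.isDomain_iff_prime _).1 this) hmin

/-- If `p ≤ 𝔪²`, passing to `R/p` could not lower the embedding dimension. So some `x ∈ p` lies
outside `𝔪²`; then `R/x` is a domain of dimension `d` mapping onto `R/p` of the same dimension,
which leaves no room for a kernel. -/
theorem IsRegularLocalRing.exists_eq_span_singleton {R : Type u} [CommRing R]
    [IsRegularLocalRing R] {p : Ideal R} [IsRegularLocalRing (R ⧸ p)] {d : ℕ}
    (hd : ringKrullDim R = (d + 1 : ℕ)) (hp : ringKrullDim (R ⧸ p) = d) :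
    ∃ x, p = Ideal.span {x} := by
  obtain ⟨x, hxp, hx2⟩ : ∃ x ∈ p, x ∉ maximalIdeal R ^ 2 := by
    by_contra! hcon
    have h := IsLocalRing.spanFinrank_maximalIdeal_le_of_le_sq (p := p) hcon
    have h1 := IsRegularLocalRing.spanFinrank_maximalIdeal (R := R)
    have h2 := IsRegularLocalRing.spanFinrank_maximalIdeal (R := R ⧸ p)
    rw [hd] at h1
    rw [hp] at h2
    have h1 : (maximalIdeal R).spanFinrank = d + 1 := by exact_mod_cast h1
    have h2 : (maximalIdeal (R ⧸ p)).spanFinrank = d := by exact_mod_cast h2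
    omega
  have hpm : p ≠ ⊤ := Ideal.Quotient.nontrivial_iff.1 inferInstance
  obtain ⟨hreg, hdim⟩ :=
    IsRegularLocalRing.quotient_span_singleton (le_maximalIdeal hpm hxp) hx2 hd
  have hdom := IsRegularLocalRing.isDomain_of_ringKrullDim_eq d hdim
  have hxp' : Ideal.span {x} ≤ p := (Ideal.span_singleton_le_iff_mem _).2 hxp
  refine ⟨x, le_antisymm (fun y hy ↦ ?_) hxp'⟩
  rw [← Ideal.Quotient.eq_zero_iff_mem]
  by_contra hne
  have h := ringKrullDim_succ_le_of_surjective (Ideal.Quotient.factor hxp')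
    (Ideal.Quotient.factor_surjective hxp') (mem_nonZeroDivisors_of_ne_zero hne)
    (by simpa [Ideal.Quotient.eq_zero_iff_mem] using hy)
  rw [hp, hdim] at h
  have : d + 1 ≤ d := by exact_mod_cast h
  omega

end RegularLocal

/-! ### Adic completion of rings: functoriality, kernels, Noetherianity. -/

section Completion

namespace AdicCompletion

variable {A B : Type u} [CommRing A] [CommRing B] (I : Ideal A) (J : Ideal B) (f : A →+* B)
  (h : I.map f ≤ J)

theorem AdicCauchySequence.sub_mem {I : Ideal A} (x : AdicCauchySequence I A) {m n : ℕ}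
    (hmn : m ≤ n) : x n - x m ∈ I ^ m :=
  Ideal.Quotient.eq.1 (AdicCompletion.Ideal.mk_eq_mk I hmn x)

theorem map_mem_pow {I : Ideal A} {J : Ideal B} {f : A →+* B} (h : I.map f ≤ J) {n : ℕ} {x : A}
    (hx : x ∈ I ^ n) : f x ∈ J ^ n :=
  Ideal.pow_right_mono h n (Ideal.map_pow f I n ▸ Ideal.mem_map_of_mem f hx)

theorem pow_le_comap {I : Ideal A} {J : Ideal B} {f : A →+* B} (h : I.map f ≤ J) (n : ℕ) :
    I ^ n ≤ (J ^ n).comap f :=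
  fun _ ↦ map_mem_pow h

theorem factorPow_comp_quotientMap_comp_evalₐ {m n : ℕ} (hmn : m ≤ n) :
    (Ideal.Quotient.factorPow J hmn).comp ((Ideal.quotientMap (J ^ n) f (pow_le_comap h n)).comp
      (evalₐ I n : AdicCompletion I A →+* A ⧸ I ^ n)) =
    (Ideal.quotientMap (J ^ m) f (pow_le_comap h m)).comp
      (evalₐ I m : AdicCompletion I A →+* A ⧸ I ^ m) := by
  ext x
  induction x using AdicCompletion.induction_on with | _ x
  simp only [RingHom.comp_apply, RingHom.coe_coe, evalₐ_mk]
  refine Ideal.Quotient.eq.2 ?_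
  rw [← map_sub]
  exact map_mem_pow h (AdicCauchySequence.sub_mem x hmn)

/-- A ring homomorphism `f : A → B` with `f(I) ⊆ J` induces a homomorphism from the `I`-adic
completion of `A` to the `J`-adic completion of `B`. -/
noncomputable def mapRingHom : AdicCompletion I A →+* AdicCompletion J B :=
  liftRingHom J _ (factorPow_comp_quotientMap_comp_evalₐ I J f h)

theorem evalₐ_mapRingHom (n : ℕ) (x : AdicCompletion I A) :
    evalₐ J n (mapRingHom I J f h x) =
      Ideal.quotientMap (J ^ n) f (pow_le_comap h n) (evalₐ I n x) :=
  evalₐ_liftRingHom J _ (factorPow_comp_quotientMap_comp_evalₐ I J f h) n x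

theorem evalₐ_mapRingHom_mk (n : ℕ) (x : AdicCauchySequence I A) :
    evalₐ J n (mapRingHom I J f h (mk I A x)) = Ideal.Quotient.mk (J ^ n) (f (x n)) := by
  rw [evalₐ_mapRingHom, evalₐ_mk]
  rfl

theorem mapRingHom_algebraMap (x : A) :
    mapRingHom I J f h (algebraMap A (AdicCompletion I A) x) =
      algebraMap B (AdicCompletion J B) (f x) := by
  refine ext_evalₐ fun n ↦ ?_
  rw [evalₐ_mapRingHom]
  simp only [algebraMap_apply, evalₐ_of, Algebra.algebraMap_self, RingHom.id_apply]
  rfl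

variable {I J f}

/-- Bridge between completing `B` as an `A`-module and as a ring, so that exactness for modules can
be used for `mapRingHom`. -/
theorem mem_pow_smul_top_iff [Algebra A B] (n : ℕ) (x : B) :
    x ∈ (I ^ n • ⊤ : Submodule A B) ↔ x ∈ (I.map (algebraMap A B)) ^ n := by
  rw [Ideal.smul_top_eq_map, ← Ideal.map_pow]
  rfl

theorem val_mk_eq_iff {M : Type*} [AddCommGroup M] [Module A M] (x y : AdicCauchySequence I M)
    (n : ℕ) : (mk I M x).val n = (mk I M y).val n ↔ x n - y n ∈ (I ^ n • ⊤ : Submodule A M) :=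
  Submodule.Quotient.eq _

theorem mapRingHom_surjective (hJ : I.map f = J) (hf : Function.Surjective f) :
    Function.Surjective (mapRingHom I J f hJ.le) := by
  subst hJ
  algebraize [f]
  intro y
  induction y using AdicCompletion.induction_on with | _ y
  let y' : AdicCauchySequence I B := ⟨y.1, fun {m n} hmn ↦ by
    rw [SModEq.sub_mem, mem_pow_smul_top_iff, ← neg_mem_iff, neg_sub]
    exact AdicCauchySequence.sub_mem y hmn⟩
  obtain ⟨x, hx⟩ := map_surjective I (f := Algebra.linearMap A B) hf (mk I B y')
  induction x using AdicCompletion.induction_on with | _ x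
  refine ⟨mk I A x, ext_evalₐ fun n ↦ ?_⟩
  rw [evalₐ_mapRingHom_mk, evalₐ_mk]
  have := congrArg (fun z ↦ z.val n) hx
  rw [map_mk, val_mk_eq_iff, mem_pow_smul_top_iff] at this
  exact Ideal.Quotient.eq.2 this

/-- By exactness, `x` comes from the completion of the kernel. The kernel is finitely generated, so
its completion is a quotient of `Â ⊗ ker`. -/
theorem mem_map_of_map_eq_zero [IsNoetherianRing A] [Algebra A B]
    (hf : Function.Surjective (algebraMap A B))
    (x : AdicCompletion I A) (hx : map I (Algebra.linearMap A B) x = 0) :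
    x ∈ (RingHom.ker (algebraMap A B)).map (algebraMap A (AdicCompletion I A)) := by
  have hex := map_exact (I := I) (f := (LinearMap.ker (Algebra.linearMap A B)).subtype)
    (g := Algebra.linearMap A B) (Submodule.injective_subtype _)
    (LinearMap.exact_subtype_ker_map _) hf
  obtain ⟨y, rfl⟩ := (hex x).1 hx
  obtain ⟨z, rfl⟩ := ofTensorProduct_surjective_of_finite I
    (LinearMap.ker (Algebra.linearMap A B)) y
  induction z with
  | zero => simp
  | add z w hz hw =>
    rw [map_add, map_add]
    refine add_mem (hz ?_) (hw ?_) <;> exact (hex _).2 ⟨_, rfl⟩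
  | tmul r k =>
    rw [ofTensorProduct_tmul, map_smul, map_of, smul_eq_mul]
    exact Ideal.mul_mem_left _ _ (Ideal.mem_map_of_mem _ k.2)

theorem ker_mapRingHom [IsNoetherianRing A] (hJ : I.map f = J) (hf : Function.Surjective f) :
    RingHom.ker (mapRingHom I J f hJ.le) =
      (RingHom.ker f).map (algebraMap A (AdicCompletion I A)) := by
  subst hJ
  refine le_antisymm (fun x hx ↦ ?_) ?_
  · algebraize [f]
    refine mem_map_of_map_eq_zero hf x ?_
    ext n
    induction x using AdicCompletion.induction_on with | _ x
    have := congrArg (evalₐ _ n) hx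
    rw [evalₐ_mapRingHom_mk, _root_.map_zero, Ideal.Quotient.eq_zero_iff_mem] at this
    rw [map_mk]
    refine (Submodule.Quotient.mk_eq_zero _).2 ?_
    exact (mem_pow_smul_top_iff n _).2 this
  · rw [Ideal.map_le_iff_le_comap]
    intro x hx
    rw [Ideal.mem_comap, RingHom.mem_ker, mapRingHom_algebraMap, (RingHom.mem_ker).1 hx, _root_.map_zero]

end AdicCompletion

/-- A ring `R` complete for the `J`-adic topology is Noetherian if `R / x` is Noetherian for some
`x ∈ J`. -/
theorem IsAdicComplete.isNoetherianRing_of_quotient {R : Type*} [CommRing R] (J : Ideal R)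
    [IsAdicComplete J R] {x : R} (hx : x ∈ J) [IsNoetherianRing (R ⧸ Ideal.span {x})] :
    IsNoetherianRing R := by
  -- Cohen's criterion: only prime ideals need be finitely generated.
  refine IsNoetherianRing.of_prime fun P hP ↦ ?_
  set π := Ideal.Quotient.mk (Ideal.span {x})
  have hπ : Function.Surjective π := Ideal.Quotient.mk_surjective
  obtain ⟨n, s, hs⟩ := Submodule.fg_iff_exists_fin_generating_family.1
    (P.map π).fg_of_isNoetherianRing
  have hsP (i : Fin n) : ∃ a ∈ P, π a = s i :=
    (Ideal.mem_map_iff_of_surjective π hπ).1 (hs ▸ Submodule.subset_span ⟨i, rfl⟩)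
  choose a haP has using hsP
  have haP' : Ideal.span (Set.range a) ≤ P := Ideal.span_le.2 (Set.range_subset_iff.2 haP)
  have hgen (y : R) (hy : y ∈ P) : ∃ (c : Fin n → R) (z : R), y = ∑ i, c i * a i + x * z := by
    have := Ideal.mem_map_of_mem π hy
    rw [← hs, Submodule.mem_span_range_iff_exists_fun] at this
    obtain ⟨c, hc⟩ := this
    choose c' hc' using fun i ↦ hπ (c i)
    have hmem : y - ∑ i, c' i * a i ∈ Ideal.span {x} := by
      rw [← Ideal.Quotient.eq]
      simp only [map_sum, map_mul]
      rw [← hc]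
      exact Finset.sum_congr rfl fun i _ ↦ by rw [← hc', ← has]; rfl
    obtain ⟨z, hz⟩ := Ideal.mem_span_singleton.1 hmem
    exact ⟨c', z, by rw [← hz]; ring⟩
  by_cases hxP : x ∈ P
  · have : P = Ideal.span (Set.range a ∪ {x}) := by
      rw [Ideal.span_union]
      refine le_antisymm (fun y hy ↦ ?_)
        (sup_le haP' ((Ideal.span_singleton_le_iff_mem _).2 hxP))
      obtain ⟨c, z, rfl⟩ := hgen y hy
      exact Submodule.add_mem_sup
        (sum_mem fun i _ ↦ Ideal.mul_mem_left _ _ (Ideal.subset_span ⟨i, rfl⟩))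
        (Ideal.mul_mem_right _ _ (Ideal.mem_span_singleton_self x))
    rw [this]
    exact Submodule.fg_span ((Set.finite_range a).union (Set.finite_singleton x))
  -- Since `P` is prime and `x ∉ P`, the cofactor `z` is again in `P`, so the expansion can be
  -- iterated.
  · have hgen' (y : P) : ∃ (c : Fin n → R) (z : P), (y : R) = ∑ i, c i * a i + x * z := by
      obtain ⟨c, z, hcz⟩ := hgen y y.2
      refine ⟨c, ⟨z, ?_⟩, hcz⟩
      have : x * z ∈ P := by
        rw [← sub_eq_iff_eq_add'] at hcz
        rw [← hcz]
        exact P.sub_mem y.2 (sum_mem fun i _ ↦ P.mul_mem_left _ (haP i))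
      exact (hP.mem_or_mem this).resolve_left hxP
    choose C Z hCZ using hgen'
    suffices P = Ideal.span (Set.range a) from this ▸ Submodule.fg_span (Set.finite_range a)
    refine le_antisymm (fun y hy ↦ ?_) haP'
    -- Partial sums of the power series in `x` for the `i`-th coefficient; `Z^[k]` is the `k`-th
    -- remainder. They converge because `x ∈ J`.
    let S (i : Fin n) (N : ℕ) : R := ∑ k ∈ Finset.range N, x ^ k * C (Z^[k] ⟨y, hy⟩) i
    have hS (N : ℕ) : y = ∑ i, S i N * a i + x ^ N * Z^[N] ⟨y, hy⟩ := by
      induction N with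
      | zero => simp [S]
      | succ N ih =>
        conv_lhs => rw [ih, hCZ]
        simp only [S, Finset.sum_range_succ, add_mul, Finset.sum_add_distrib,
          Function.iterate_succ_apply', mul_add, Finset.mul_sum, pow_succ, mul_assoc, add_assoc]
    have hcauchy (i : Fin n) : ∃ L, ∀ N, S i N ≡ L [SMOD (J ^ N • ⊤ : Ideal R)] := by
      refine IsPrecomplete.prec inferInstance fun {m k} hmk ↦ ?_
      rw [SModEq.comm, SModEq.sub_mem, smul_eq_mul, Ideal.mul_top]
      simp only [S]
      rw [← Finset.sum_sdiff (Finset.range_mono hmk), add_sub_cancel_right]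
      refine sum_mem fun j hj ↦ Ideal.mul_mem_right _ _ ?_
      have : m ≤ j := by simp at hj; exact hj.2
      exact Ideal.pow_le_pow_right this (Ideal.pow_mem_pow hx j)
    choose T hT using hcauchy
    have : y - ∑ i, T i * a i = 0 := by
      refine IsHausdorff.haus (I := J) inferInstance _ fun N ↦ ?_
      rw [SModEq.zero, smul_eq_mul, Ideal.mul_top]
      have h1 : y - ∑ i, T i * a i = ∑ i, (S i N - T i) * a i + x ^ N * Z^[N] ⟨y, hy⟩ := by
        conv_lhs => rw [hS N]
        simp only [sub_mul, Finset.sum_sub_distrib]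
        ring
      rw [h1]
      refine add_mem (sum_mem fun i _ ↦ Ideal.mul_mem_right _ _ ?_)
        (Ideal.mul_mem_right _ _ (Ideal.pow_mem_pow hx N))
      have := hT i N
      rwa [SModEq.sub_mem, smul_eq_mul, Ideal.mul_top] at this
    rw [sub_eq_zero.1 this]
    exact sum_mem fun i _ ↦ Ideal.mul_mem_left _ _ (Ideal.subset_span ⟨i, rfl⟩)

namespace AdicCompletion

/-- Induction on the number of generators: `Â/x` is the completion of `A/x` at an ideal with one
generator fewer, and Noetherianity lifts from `Â/x` to the complete ring `Â`. -/
theorem isNoetherianRing_of_span_finset (k : ℕ) : ∀ {A : Type u} [CommRing A] [IsNoetherianRing A]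
    (s : Finset A), s.card ≤ k → IsNoetherianRing (AdicCompletion (Ideal.span (s : Set A)) A) := by
  classical
  induction k with
  | zero =>
    intro A _ _ s hs
    obtain rfl := Finset.card_eq_zero.1 (Nat.le_zero.1 hs)
    rw [Finset.coe_empty, Ideal.span_empty]
    have : IsAdicComplete (⊥ : Ideal A) A := {}
    exact isNoetherianRing_of_ringEquiv A (ofAlgEquiv (⊥ : Ideal A)).toRingEquiv
  | succ k ih =>
    intro A _ _ s hs
    by_cases hsk : s.card ≤ k
    · exact ih s hsk
    obtain ⟨x, t, hxt, rfl, ht⟩ := Finset.card_eq_succ.1 (hs.antisymm (Nat.lt_of_not_le hsk))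
    set I := Ideal.span ((insert x t : Finset A) : Set A) with hI
    have hxI : x ∈ I := Ideal.subset_span (by simp)
    let π := Ideal.Quotient.mk (Ideal.span {x})
    have hmap : I.map π = Ideal.span (t.image π : Set (A ⧸ Ideal.span {x})) := by
      have hx0 : π x = 0 := Ideal.Quotient.eq_zero_iff_mem.2 (Ideal.mem_span_singleton_self x)
      rw [hI, Ideal.map_span, Finset.coe_insert, Set.image_insert_eq, hx0, Ideal.span_insert_zero,
        Finset.coe_image]
    have hnoeth : IsNoetherianRing (AdicCompletion (I.map π) (A ⧸ Ideal.span {x})) := by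
      rw [hmap]
      exact ih _ (Finset.card_image_le.trans ht.le)
    have := isAdicComplete_self I I.fg_of_isNoetherianRing
    have hker := ker_mapRingHom (I := I) (f := π) rfl Ideal.Quotient.mk_surjective
    have hspan : RingHom.ker (mapRingHom I _ π le_rfl) =
        Ideal.span {algebraMap A (AdicCompletion I A) x} := by
      rw [hker, Ideal.mk_ker, Ideal.map_span, Set.image_singleton]
    have hquot : IsNoetherianRing
        (AdicCompletion I A ⧸ Ideal.span {algebraMap A (AdicCompletion I A) x}) := by
      rw [← hspan]
      exact isNoetherianRing_of_ringEquiv _ (RingHom.quotientKerEquivOfSurjective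
        (mapRingHom_surjective (I := I) (f := π) rfl Ideal.Quotient.mk_surjective)).symm
    exact IsAdicComplete.isNoetherianRing_of_quotient (I.map (algebraMap A (AdicCompletion I A)))
      (Ideal.mem_map_of_mem _ hxI)

theorem isNoetherianRing {A : Type u} [CommRing A] [IsNoetherianRing A] (I : Ideal A) :
    IsNoetherianRing (AdicCompletion I A) := by
  obtain ⟨s, rfl⟩ := I.fg_of_isNoetherianRing
  exact isNoetherianRing_of_span_finset _ s le_rfl

end AdicCompletion

end Completion

/-! ### From adic completeness to completeness of the fraction field. -/

section CompleteDVR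

open IsLocalRing MonoidWithZeroHom Filter Topology Uniformity

/-- The balls `v ≤ exp(-n)` are the powers `Iⁿ`, so a Cauchy sequence, translated into the valuation
ring, has an `I`-adic limit. -/
theorem Valuation.completeSpace_of_isPrecomplete {R K : Type*} [CommRing R] [Field K] [Algebra R K]
    (v : Valuation K ℤᵐ⁰) (hv : Function.Surjective v) (I : Ideal R) [IsPrecomplete I R]
    (hint : ∀ x, v x ≤ 1 → ∃ r, algebraMap R K r = x)
    (hpow : ∀ r (n : ℕ), v (algebraMap R K r) ≤ WithZero.exp (-(n : ℤ)) ↔ r ∈ I ^ n) :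
    @CompleteSpace K (Valued.mk' v).toUniformSpace := by
  let _ : Valued K ℤᵐ⁰ := Valued.mk' v
  have hpos (γ : (ValueGroup₀ (.ofClass v))ˣ) :
      ∃ n : ℕ, WithZero.exp (-(n : ℤ)) < ValueGroup₀.embedding γ.1 := by
    obtain ⟨z, hz⟩ : ∃ z : ℤ, ValueGroup₀.embedding γ.1 = WithZero.exp z :=
      ⟨WithZero.log (ValueGroup₀.embedding γ.1), by rw [WithZero.exp_log]; simp⟩
    refine ⟨z.natAbs + 1, ?_⟩
    rw [hz, WithZero.exp_lt_exp]
    omega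
  choose π hπ using fun n : ℕ ↦ hv (WithZero.exp (-(n : ℤ)))
  have hπ0 (n : ℕ) : v.restrict (π n) ≠ 0 := by
    rw [ne_eq, v.restrict_eq_zero_iff, hπ]
    exact WithZero.exp_ne_zero
  have hnhds : (𝓝 (0 : K)).HasBasis (fun _ ↦ True)
      fun n : ℕ ↦ {x | v x ≤ WithZero.exp (-(n : ℤ))} := by
    refine (Valued.hasBasis_nhds_zero K ℤᵐ⁰).to_hasBasis (fun γ _ ↦ ?_) (fun n _ ↦ ?_)
    · obtain ⟨n, hn⟩ := hpos γ
      exact ⟨n, trivial, fun x hx ↦ v.restrict_lt_iff_lt_embedding.2 (lt_of_le_of_lt hx hn)⟩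
    · refine ⟨Units.mk0 _ (hπ0 n), trivial, fun x hx ↦ ?_⟩
      have := v.restrict_lt_iff.1 hx
      rw [hπ] at this
      exact this.le
  have := hnhds.isCountablyGenerated
  have : (𝓤 K).IsCountablyGenerated := IsUniformAddGroup.uniformity_countably_generated
  refine UniformSpace.complete_of_cauchySeq_tendsto fun u hu ↦ ?_
  have hN : ∀ k : ℕ, ∃ N, ∀ m, N ≤ m → ∀ n, N ≤ n → v (u n - u m) ≤ WithZero.exp (-(k : ℤ)) := by
    simpa using hnhds.uniformity_of_nhds_zero.cauchySeq_iff.mp hu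
  choose N hN using hN
  -- A monotone choice of thresholds; the terms `u (M k)` form a subsequence with controlled rate.
  let M (k : ℕ) : ℕ := (Finset.Iic k).sup N
  have hM {i k : ℕ} (hik : i ≤ k) : N i ≤ M k := Finset.le_sup (by simpa)
  have hf (k : ℕ) : ∃ r, algebraMap R K r = u (M k) - u (M 0) := by
    refine hint _ ((hN 0 _ (hM le_rfl) _ (hM (Nat.zero_le k))).trans ?_)
    simp
  choose f hf using hf
  obtain ⟨L, hL⟩ : ∃ L, ∀ k, f k ≡ L [SMOD (I ^ k • ⊤ : Ideal R)] := by
    refine IsPrecomplete.prec inferInstance fun {m n} hmn ↦ ?_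
    rw [SModEq.sub_mem, smul_eq_mul, Ideal.mul_top, ← hpow, _root_.map_sub, hf, hf,
      sub_sub_sub_cancel_right]
    exact hN m _ (hM hmn) _ (hM le_rfl)
  refine ⟨u (M 0) + algebraMap R K L, ?_⟩
  have hb : (𝓝 (u (M 0) + algebraMap R K L)).HasBasis (fun _ ↦ True)
      fun n : ℕ ↦ {x | v (x - (u (M 0) + algebraMap R K L)) ≤ WithZero.exp (-(n : ℤ))} := by
    rw [← nhds_translation_sub]
    exact hnhds.comap _
  rw [hb.tendsto_right_iff]
  intro k _
  filter_upwards [eventually_ge_atTop (M k)] with n hn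
  have h1 : u n - (u (M 0) + algebraMap R K L) = (u n - u (M k)) + algebraMap R K (f k - L) := by
    rw [_root_.map_sub, hf]
    ring
  have h2 := hL k
  rw [SModEq.sub_mem, smul_eq_mul, Ideal.mul_top, ← hpow] at h2
  change v _ ≤ _
  rw [h1]
  exact v.map_add_le (hN k _ (hM le_rfl) _ ((hM le_rfl).trans hn)) h2

/-- The fraction field of a complete discrete valuation ring is a complete discrete valuation
field. -/
theorem IsDiscreteValuationRing.isCompleteDiscreteValuation (R : Type*) {K : Type u} [CommRing R]
    [IsDomain R] [IsDiscreteValuationRing R] [IsAdicComplete (IsLocalRing.maximalIdeal R) R] [Field K]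
    [Algebra R K] [IsFractionRing R K] :
    IsCompleteDiscreteValuation ((IsDiscreteValuationRing.maximalIdeal R).valuation K) where
  isField := Field.toIsField K
  surjective := (IsDiscreteValuationRing.maximalIdeal R).valuation_surjective K
  complete := Valuation.completeSpace_of_isPrecomplete _
    ((IsDiscreteValuationRing.maximalIdeal R).valuation_surjective K) (IsLocalRing.maximalIdeal R)
    (fun _ hx ↦ IsDiscreteValuationRing.exists_lift_of_le_one hx)
    (fun r n ↦ by
      rw [IsDedekindDomain.HeightOneSpectrum.valuation_of_algebraMap]
      exact IsDedekindDomain.HeightOneSpectrum.intValuation_le_pow_iff_mem _ r n)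

end CompleteDVR

/-! ### Principal chains and their stability under completion and localisation. -/

section PrincipalChain

open IsLocalRing

theorem ringKrullDim_quotient_add_one_le_of_lt {R : Type*} [CommRing R] {p q : Ideal R}
    [p.IsPrime] (hpq : p < q) : ringKrullDim (R ⧸ q) + 1 ≤ ringKrullDim (R ⧸ p) := by
  obtain ⟨x, hxq, hxp⟩ := SetLike.exists_of_lt hpq
  refine ringKrullDim_succ_le_of_surjective (Ideal.Quotient.factor hpq.le)
    (Ideal.Quotient.factor_surjective hpq.le) (r := Ideal.Quotient.mk p x)
    (mem_nonZeroDivisors_of_ne_zero ?_) ?_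
  · rwa [ne_eq, Ideal.Quotient.eq_zero_iff_mem]
  · rwa [Ideal.Quotient.factor_mk, Ideal.Quotient.eq_zero_iff_mem]

/-- If `p ⊂ q` are ideals of `R` such that `R / p` and `R / q` are regular local rings of
dimensions `d + 1` and `d`, then `q` is generated by `p` and one more element. -/
theorem exists_eq_sup_span_singleton {R : Type u} [CommRing R] {p q : Ideal R} (hpq : p ≤ q)
    [IsRegularLocalRing (R ⧸ p)] [IsRegularLocalRing (R ⧸ q)] {d : ℕ}
    (hp : ringKrullDim (R ⧸ p) = (d + 1 : ℕ)) (hq : ringKrullDim (R ⧸ q) = d) :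
    ∃ x, q = p ⊔ Ideal.span {x} := by
  let e := DoubleQuot.quotQuotEquivQuotOfLE hpq
  have := IsRegularLocalRing.of_ringEquiv e.symm
  obtain ⟨y, hy⟩ := IsRegularLocalRing.exists_eq_span_singleton
    (p := q.map (Ideal.Quotient.mk p)) hp ((ringKrullDim_eq_of_ringEquiv e).trans hq)
  obtain ⟨x, rfl⟩ := Ideal.Quotient.mk_surjective y
  refine ⟨x, ?_⟩
  have := congrArg (Ideal.comap (Ideal.Quotient.mk p)) hy
  rw [← Set.image_singleton, ← Ideal.map_span,
    Ideal.comap_map_of_surjective' _ Ideal.Quotient.mk_surjective,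
    Ideal.comap_map_of_surjective' _ Ideal.Quotient.mk_surjective, Ideal.mk_ker,
    sup_eq_left.2 hpq] at this
  rw [this, sup_comm]

/-- `Â/pÂ` is the completion `C` of the domain `A/p`, a Noetherian local ring. The image of `x` in
`C` is a nonzerodivisor by flatness and generates a prime ideal by hypothesis, so `C` is a domain.
-/
theorem AdicCompletion.isPrime_map_of_isPrime_map_sup {A : Type u} [CommRing A]
    [IsNoetherianRing A] (m p : Ideal A) [m.IsMaximal] [p.IsPrime] {x : A} (hpm : p ≤ m)
    (hxm : x ∈ m) (hxp : x ∉ p)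
    (h : ((p ⊔ Ideal.span {x}).map (algebraMap A (AdicCompletion m A))).IsPrime) :
    (p.map (algebraMap A (AdicCompletion m A))).IsPrime ∧
      algebraMap A (AdicCompletion m A) x ∉ p.map (algebraMap A (AdicCompletion m A)) := by
  set π := Ideal.Quotient.mk p
  have hπ : Function.Surjective π := Ideal.Quotient.mk_surjective
  set n := m.map π with hn
  have hnmax : n.IsMaximal := Ideal.IsMaximal.map_of_surjective_of_ker_le hπ (by
    rwa [Ideal.mk_ker])
  set C := AdicCompletion n (A ⧸ p)
  set φ : AdicCompletion m A →+* C := mapRingHom m n π le_rfl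
  have hφ : Function.Surjective φ := mapRingHom_surjective rfl hπ
  have hker : RingHom.ker φ = p.map (algebraMap A (AdicCompletion m A)) :=
    (ker_mapRingHom rfl hπ).trans (by rw [Ideal.mk_ker])
  have hφx : φ (algebraMap A (AdicCompletion m A) x) = algebraMap (A ⧸ p) C (π x) :=
    mapRingHom_algebraMap m n π le_rfl x
  have : IsNoetherianRing C := isNoetherianRing n
  have hmax := isMaximal_map_of_le n n le_rfl n.fg_of_isNoetherianRing
  have := isAdicComplete_self n n.fg_of_isNoetherianRing
  have : IsLocalRing C :=
    isLocalRing_of_isAdicComplete_maximal (n.map (algebraMap (A ⧸ p) C))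
  set y := algebraMap (A ⧸ p) C (π x) with hy
  have hym : y ∈ maximalIdeal C :=
    le_maximalIdeal hmax.ne_top (Ideal.mem_map_of_mem _ (Ideal.mem_map_of_mem _ hxm))
  have hreg : y ∈ nonZeroDivisors C := by
    have : IsSMulRegular C (π x) := Module.Flat.isSMulRegular_of_nonZeroDivisors
      (mem_nonZeroDivisors_of_ne_zero (by rwa [ne_eq, Ideal.Quotient.eq_zero_iff_mem]))
    refine mem_nonZeroDivisors_iff_right.2 fun z hz ↦ this ?_
    change π x • z = π x • 0
    rw [smul_zero, Algebra.smul_def, mul_comm, hz]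
  have hspan : ((p ⊔ Ideal.span {x}).map (algebraMap A (AdicCompletion m A))).map φ =
      Ideal.span {y} := by
    rw [Ideal.map_sup, Ideal.map_sup, ← hker, Ideal.map_span, Ideal.map_span,
      Set.image_singleton, Set.image_singleton, hφx,
      (Ideal.map_eq_bot_iff_le_ker φ).2 le_rfl, bot_sup_eq]
  have hprime : (Ideal.span {y}).IsPrime := by
    rw [← hspan]
    refine Ideal.map_isPrime_of_surjective hφ ?_
    rw [hker]
    exact Ideal.map_mono le_sup_left
  -- Minimal primes contain no nonzerodivisors, hence not `y`.
  have hdom := IsLocalRing.isDomain_of_isPrime_span_singleton hym hprime fun q hq hyq ↦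
    Set.disjoint_left.1 (Ideal.disjoint_nonZeroDivisors_of_mem_minimalPrimes hq) hyq hreg
  rw [← hker]
  refine ⟨RingHom.ker_isPrime φ, ?_⟩
  rw [RingHom.mem_ker, hφx]
  exact nonZeroDivisors.ne_zero hreg

namespace IdealChain

variable {n : ℕ}

/-- A chain of primes `0 = 𝔭₀ ⊂ ⋯ ⊂ 𝔭ₙ` in a Noetherian ring such that `𝔭ₙ` is maximal and every
`𝔭ᵢ₊₁` is generated by `𝔭ᵢ` and one more element. -/
structure IsPrincipal (A : IdealChain.{u} n) : Prop where
  isNoetherianRing : IsNoetherianRing A.ring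
  bot : A.ideal 0 = ⊥
  isMaximal : (A.ideal (Fin.last n)).IsMaximal
  prime : ∀ i, (A.ideal i).IsPrime
  exists_generator : ∀ i : Fin n, ∃ x, x ∉ A.ideal i.castSucc ∧
    A.ideal i.succ = A.ideal i.castSucc ⊔ Ideal.span {x}

theorem IsPrincipal.monotone {A : IdealChain.{u} n} (hA : A.IsPrincipal) : Monotone A.ideal :=
  Fin.monotone_iff_le_succ.2 fun i ↦ by
    obtain ⟨x, -, hx⟩ := hA.exists_generator i
    exact hx ▸ le_sup_left

/-- Each strict inclusion lowers the dimension of the quotient by at least 1. With `n` steps between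
dimension at most `n` and at least 0, every drop is exactly 1. -/
theorem IsRegular.isPrincipal {A : IdealChain.{u} n} (hA : A.IsRegular) : A.IsPrincipal := by
  have := hA.regular
  have := hA.prime
  have := hA.regular_quotient
  -- By regularity this is the dimension of `A/𝔭ᵢ`, as a natural number.
  let d (i : Fin (n + 1)) : ℕ := (maximalIdeal (A.ring ⧸ A.ideal i)).spanFinrank
  have hd (i) : ringKrullDim (A.ring ⧸ A.ideal i) = d i :=
    (IsRegularLocalRing.spanFinrank_maximalIdeal (R := A.ring ⧸ A.ideal i)).symm
  have hstep (i : Fin n) : d i.succ + 1 ≤ d i.castSucc := by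
    have := ringKrullDim_quotient_add_one_le_of_lt
      (hA.strictMono (Fin.castSucc_lt_succ (i := i)))
    rw [hd, hd] at this
    exact_mod_cast this
  have hle (i) : d i + i ≤ n := by
    induction i using Fin.induction with
    | zero =>
      have := ringKrullDim_quotient_le (A.ideal 0)
      rw [hd, hA.dim] at this
      simpa using this
    | succ i ih =>
      have := hstep i
      simp only [Fin.val_succ, Fin.val_castSucc] at ih ⊢
      omega
  have hge (i) : n ≤ d i + i := by
    induction i using Fin.reverseInduction with
    | last => simp
    | cast i ih =>
      have := hstep i
      simp only [Fin.val_succ, Fin.val_castSucc] at ih ⊢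
      omega
  have hdom := IsRegularLocalRing.isDomain_of_ringKrullDim_eq n hA.dim
  refine ⟨inferInstance, ?_, ?_, hA.prime, fun i ↦ ?_⟩
  · rw [eq_bot_iff]
    intro r hr
    by_contra hne
    have := ringKrullDim_succ_le_of_surjective (Ideal.Quotient.mk (A.ideal 0))
      Ideal.Quotient.mk_surjective (mem_nonZeroDivisors_of_ne_zero hne)
      (Ideal.Quotient.eq_zero_iff_mem.2 hr)
    rw [hd, hA.dim] at this
    have h1 : d 0 + 1 ≤ n := by exact_mod_cast this
    have h2 := hge 0
    simp only [Fin.val_zero] at h2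
    omega
  · have h0 : d (Fin.last n) = 0 := by
      have := hle (Fin.last n)
      simp only [Fin.val_last] at this
      omega
    have h1 := hd (Fin.last n)
    rw [h0, Nat.cast_zero, ← ringKrullDimZero_iff_ringKrullDim_eq_zero] at h1
    exact Ideal.Quotient.maximal_of_isField _ Ring.KrullDimLE.isField_of_isDomain
  · have hlt := hA.strictMono (Fin.castSucc_lt_succ (i := i))
    have h1 := hd i.castSucc
    have h2 : d i.castSucc = d i.succ + 1 := by
      have := hge i.castSucc; have := hle i.castSucc; have := hge i.succ; have := hle i.succ
      simp only [Fin.val_succ, Fin.val_castSucc] at *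
      omega
    rw [h2] at h1
    obtain ⟨x, hx⟩ := exists_eq_sup_span_singleton hlt.le h1 (hd i.succ)
    refine ⟨x, fun hxi ↦ hlt.ne ?_, hx⟩
    rw [hx, sup_eq_left.2 ((Ideal.span_singleton_le_iff_mem _).2 hxi)]

/-- Primality descends from `𝔭ᵢ₊₁Â` to `𝔭ᵢÂ`, starting at the maximal ideal `𝔭ₙÂ`. -/
theorem IsPrincipal.comp {A : IdealChain.{u} n} (hA : A.IsPrincipal) : A.comp.IsPrincipal := by
  have := hA.isNoetherianRing
  have := hA.prime
  have := hA.isMaximal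
  have hkey (i : Fin n) (hi : (A.comp.ideal i.succ).IsPrime) : (A.comp.ideal i.castSucc).IsPrime ∧
      ∃ x, x ∉ A.comp.ideal i.castSucc ∧
        A.comp.ideal i.succ = A.comp.ideal i.castSucc ⊔ Ideal.span {x} := by
    obtain ⟨x, hxp, hx⟩ := hA.exists_generator i
    have hmem : x ∈ A.ideal (Fin.last n) :=
      hA.monotone (Fin.le_last i.succ)
        (hx ▸ Ideal.mem_sup_right (Ideal.mem_span_singleton_self x))
    have hi' : ((A.ideal i.succ).map (algebraMap A.ring
      (AdicCompletion (A.ideal (Fin.last n)) A.ring))).IsPrime := hi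
    rw [hx] at hi'
    obtain ⟨h1, h2⟩ := AdicCompletion.isPrime_map_of_isPrime_map_sup (A.ideal (Fin.last n))
      (A.ideal i.castSucc) (hA.monotone (Fin.le_last _)) hmem hxp hi'
    refine ⟨h1, _, h2, ?_⟩
    change (A.ideal i.succ).map _ = (A.ideal i.castSucc).map _ ⊔ _
    rw [hx, Ideal.map_sup, Ideal.map_span, Set.image_singleton]
    rfl
  have hmax : (A.comp.ideal (Fin.last n)).IsMaximal :=
    AdicCompletion.isMaximal_map_of_le _ _ le_rfl (A.ideal (Fin.last n)).fg_of_isNoetherianRing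
  have hprime (i) : (A.comp.ideal i).IsPrime := by
    induction i using Fin.reverseInduction with
    | last => exact hmax.isPrime
    | cast i ih => exact (hkey i ih).1
  refine ⟨AdicCompletion.isNoetherianRing (A.ideal (Fin.last n)), ?_, hmax, hprime,
    fun i ↦ (hkey i (hprime _)).2⟩
  change (A.ideal 0).map _ = _
  rw [hA.bot, Ideal.map_bot]
  rfl

theorem isLocalization_atPrime_of_complMonoid {R : Type*} [CommRing R] (p : Ideal R) [p.IsPrime]
    (S : Type*) [CommRing S] [Algebra R S] [IsLocalization (complMonoid p) S] :
    IsLocalization.AtPrime S p := by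
  rwa [IsLocalization.AtPrime, ← complMonoid_eq_primeCompl]

theorem IsPrincipal.loc {A : IdealChain.{u} (n + 1)} (hA : A.IsPrincipal) :
    A.loc.IsPrincipal := by
  have := hA.isNoetherianRing
  have := hA.prime
  set p := A.ideal (Fin.last n).castSucc
  set S := Localization (complMonoid p)
  have hloc : IsLocalization.AtPrime S p := isLocalization_atPrime_of_complMonoid p S
  have hle (i : Fin (n + 1)) : A.ideal i.castSucc ≤ p :=
    hA.monotone (Fin.castSucc_le_castSucc_iff.2 (Fin.le_last i))
  have hdisj (i : Fin (n + 1)) :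
      Disjoint (p.primeCompl : Set A.ring) (A.ideal i.castSucc : Set A.ring) :=
    Set.disjoint_left.2 fun x hx hxi ↦ hx (hle i hxi)
  refine ⟨IsLocalization.isNoetherianRing p.primeCompl S inferInstance, ?_, ?_, fun i ↦ ?_,
    fun i ↦ ?_⟩
  · change (A.ideal 0).map (algebraMap A.ring S) = ⊥
    rw [hA.bot, Ideal.map_bot]
  · have := IsLocalization.AtPrime.isLocalRing S p
    have h := maximalIdeal.isMaximal S
    rwa [← IsLocalization.AtPrime.map_eq_maximalIdeal p S] at h
  · exact IsLocalization.isPrime_of_isPrime_disjoint p.primeCompl S _ (hA.prime _) (hdisj i)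
  · obtain ⟨x, hxp, hx⟩ := hA.exists_generator i.castSucc
    refine ⟨algebraMap A.ring S x, fun h ↦ hxp ?_, ?_⟩
    · rw [← IsLocalization.under_map_of_isPrime_disjoint p.primeCompl S (hA.prime _)
        (hdisj i.castSucc)]
      exact h
    · change (A.ideal i.castSucc.succ).map _ = (A.ideal i.castSucc.castSucc).map _ ⊔ _
      rw [hx, Ideal.map_sup, Ideal.map_span, Set.image_singleton]
      rfl

end IdealChain

end PrincipalChain

/-! ### Truncation commutes with completion and localisation. -/

section Truncation

namespace IdealChain

variable {n m : ℕ}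

/-- `f : A → B` identifies the chain `B` with the truncation `τᵢ A`. -/
structure IsTrunc (A : IdealChain.{u} n) (B : IdealChain.{u} m) (i : ℕ) (h : i + m = n)
    (f : A.ring →+* B.ring) : Prop where
  surjective : Function.Surjective f
  ker : RingHom.ker f = A.ideal ⟨i, by omega⟩
  map_ideal : ∀ j : Fin (m + 1), (A.ideal ⟨i + j, by omega⟩).map f = B.ideal j

theorem isTrunc_toTrunc (A : IdealChain.{u} n) (i m : ℕ) (h : i + m = n) :
    IsTrunc A (A.trunc i m h) i h (A.toTrunc i m h) where
  surjective := Ideal.Quotient.mk_surjective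
  ker := Ideal.mk_ker
  map_ideal _ := rfl

namespace IsTrunc

variable {A : IdealChain.{u} n} {B : IdealChain.{u} m} {i : ℕ} {h : i + m = n}
  {f : A.ring →+* B.ring}

theorem ker_le (hf : IsTrunc A B i h f) (hA : A.IsPrincipal) (j : Fin (m + 1)) :
    RingHom.ker f ≤ A.ideal ⟨i + j, by omega⟩ :=
  hf.ker ▸ hA.monotone (Fin.mk_le_mk.2 (Nat.le_add_right i j))

theorem comap_ideal (hf : IsTrunc A B i h f) (hA : A.IsPrincipal) (j : Fin (m + 1)) :
    (B.ideal j).comap f = A.ideal ⟨i + j, by omega⟩ := by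
  rw [← hf.map_ideal, Ideal.comap_map_of_surjective' f hf.surjective,
    sup_eq_left.2 (hf.ker_le hA j)]

theorem isPrincipal (hf : IsTrunc A B i h f) (hA : A.IsPrincipal) : B.IsPrincipal := by
  have := hA.isNoetherianRing
  have := hA.prime
  have := hA.isMaximal
  refine ⟨isNoetherianRing_of_surjective _ _ f hf.surjective, ?_, ?_, fun j ↦ ?_, fun j ↦ ?_⟩
  · rw [← hf.map_ideal, Ideal.map_eq_bot_iff_le_ker, hf.ker]
    rfl
  · rw [← hf.map_ideal]
    have hlast : A.ideal ⟨i + (Fin.last m : Fin (m + 1)), by omega⟩ = A.ideal (Fin.last n) :=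
      congrArg A.ideal (Fin.ext h)
    rw [hlast]
    exact Ideal.IsMaximal.map_of_surjective_of_ker_le hf.surjective
      (hlast ▸ hf.ker_le hA (Fin.last m))
  · rw [← hf.map_ideal]
    exact Ideal.map_isPrime_of_surjective hf.surjective (hf.ker_le hA j)
  · obtain ⟨x, hxp, hx⟩ := hA.exists_generator ⟨i + j, by omega⟩
    refine ⟨f x, fun hfx ↦ hxp ?_, ?_⟩
    · rw [← Ideal.mem_comap, hf.comap_ideal hA] at hfx
      exact hfx
    · rw [← hf.map_ideal, ← hf.map_ideal, ← Set.image_singleton, ← Ideal.map_span,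
        ← Ideal.map_sup]
      exact congrArg (Ideal.map f) hx

end IsTrunc

/-- The natural map from the ring of `A` to the ring of `comp A`. -/
noncomputable def toComp (A : IdealChain.{u} n) : A.ring →+* A.comp.ring :=
  algebraMap A.ring (AdicCompletion (A.ideal (Fin.last n)) A.ring)

/-- The natural map from the ring of `A` to the ring of `loc A`. -/
noncomputable def toLoc (A : IdealChain.{u} (n + 1)) : A.ring →+* A.loc.ring :=
  algebraMap A.ring (Localization (complMonoid (A.ideal (Fin.last n).castSucc)))

theorem map_toComp (A : IdealChain.{u} n) (i : Fin (n + 1)) :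
    (A.ideal i).map A.toComp = A.comp.ideal i :=
  rfl

theorem map_toLoc (A : IdealChain.{u} (n + 1)) (i : Fin (n + 1)) :
    (A.ideal i.castSucc).map A.toLoc = A.loc.ideal i :=
  rfl

theorem toLocComp_apply (A : IdealChain.{u} (n + 1)) (x : A.ring) :
    A.toLocComp x = A.comp.toLoc (A.toComp x) :=
  rfl

/-- The map on completions induced by a truncation. -/
theorem IsTrunc.exists_comp {A : IdealChain.{u} n} {B : IdealChain.{u} m} {i : ℕ} {h : i + m = n}
    {f : A.ring →+* B.ring} (hf : IsTrunc A B i h f) (hA : A.IsPrincipal) :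
    ∃ g : A.comp.ring →+* B.comp.ring, IsTrunc A.comp B.comp i h g ∧
      ∀ x : A.ring, g (A.toComp x) = B.toComp (f x) := by
  have := hA.isNoetherianRing
  have hJ : (A.ideal (Fin.last n)).map f = B.ideal (Fin.last m) := by
    rw [← hf.map_ideal]
    exact congrArg (fun k ↦ (A.ideal k).map f) (Fin.ext h.symm)
  obtain ⟨g, hg, hker, hcomm⟩ : ∃ g : A.comp.ring →+* B.comp.ring, Function.Surjective g ∧
      RingHom.ker g = (RingHom.ker f).map A.toComp ∧
      g.comp A.toComp = B.toComp.comp f :=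
    ⟨AdicCompletion.mapRingHom (A.ideal (Fin.last n)) (B.ideal (Fin.last m)) f hJ.le,
      AdicCompletion.mapRingHom_surjective hJ hf.surjective,
      AdicCompletion.ker_mapRingHom hJ hf.surjective,
      RingHom.ext (AdicCompletion.mapRingHom_algebraMap _ _ f hJ.le)⟩
  refine ⟨g, ⟨hg, ?_, fun j ↦ ?_⟩, fun x ↦ congr($hcomm x)⟩
  · rw [hker, hf.ker, map_toComp]
  · rw [← map_toComp, ← map_toComp, ← hf.map_ideal, Ideal.map_map, Ideal.map_map, hcomm]

/-- As `f` is surjective, the complement of `q` is the image of the complement of its preimage, so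
both numerators and denominators lift. -/
theorem exists_localization_map {R S : Type*} [CommRing R] [CommRing S] {f : R →+* S}
    (hf : Function.Surjective f) (p : Ideal R) (q : Ideal S) [q.IsPrime] (hpq : p = q.comap f) :
    ∃ g : Localization (complMonoid p) →+* Localization (complMonoid q),
      Function.Surjective g ∧
      RingHom.ker g = (RingHom.ker f).map (algebraMap R (Localization (complMonoid p))) ∧
      g.comp (algebraMap R (Localization (complMonoid p))) =
        (algebraMap S (Localization (complMonoid q))).comp f := by
  subst hpq
  have hT : (complMonoid (q.comap f)).map f = complMonoid q := by
    rw [complMonoid_eq_primeCompl, complMonoid_eq_primeCompl]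
    ext y
    constructor
    · rintro ⟨x, hx, rfl⟩
      exact hx
    · intro hy
      obtain ⟨x, rfl⟩ := hf y
      exact ⟨x, hy, rfl⟩
  have hle : complMonoid (q.comap f) ≤ (complMonoid q).comap f := by
    rw [← Submonoid.map_le_iff_le_comap, hT]
  refine ⟨IsLocalization.map (S := Localization (complMonoid (q.comap f)))
    (Localization (complMonoid q)) f hle, ?_, IsLocalization.ker_map _ f hT,
    IsLocalization.map_comp hle⟩
  intro y
  obtain ⟨s, t, rfl⟩ := IsLocalization.exists_mk'_eq (complMonoid q) y
  obtain ⟨a, rfl⟩ := hf s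
  have ht : (t : S) ∈ (complMonoid (q.comap f)).map f := by
    rw [hT]
    exact t.2
  obtain ⟨b, hb, hbt⟩ := ht
  refine ⟨IsLocalization.mk' _ a ⟨b, hb⟩, ?_⟩
  rw [IsLocalization.map_mk']
  exact congrArg _ (Subtype.ext hbt)

/-- The map on localisations induced by a truncation. -/
theorem IsTrunc.exists_loc {A : IdealChain.{u} (n + 1)} {B : IdealChain.{u} (m + 1)} {i : ℕ}
    {h : i + (m + 1) = n + 1} {f : A.ring →+* B.ring} (hf : IsTrunc A B i h f)
    (hA : A.IsPrincipal) (h' : i + m = n) :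
    ∃ g : A.loc.ring →+* B.loc.ring, IsTrunc A.loc B.loc i h' g ∧
      ∀ x : A.ring, g (A.toLoc x) = B.toLoc (f x) := by
  have := (hf.isPrincipal hA).prime
  have hcomap : A.ideal (Fin.last n).castSucc = (B.ideal (Fin.last m).castSucc).comap f := by
    rw [hf.comap_ideal hA]
    exact congrArg A.ideal (Fin.ext h'.symm)
  obtain ⟨g, hg, hker, hcomm⟩ : ∃ g : A.loc.ring →+* B.loc.ring, Function.Surjective g ∧
      RingHom.ker g = (RingHom.ker f).map A.toLoc ∧ g.comp A.toLoc = B.toLoc.comp f :=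
    exists_localization_map hf.surjective _ _ hcomap
  refine ⟨g, ⟨hg, ?_, fun j ↦ ?_⟩, fun x ↦ congr($hcomm x)⟩
  · rw [hker, hf.ker, ← map_toLoc]
    rfl
  · rw [← map_toLoc, ← map_toLoc, ← hf.map_ideal, Ideal.map_map, Ideal.map_map, ← hcomm]
    rfl

theorem IsTrunc.exists_comp_loc {A : IdealChain.{u} (n + 1)} {B : IdealChain.{u} (m + 1)} {i : ℕ}
    {h : i + (m + 1) = n + 1} {f : A.ring →+* B.ring} (hf : IsTrunc A B i h f)
    (hA : A.IsPrincipal) (h' : i + m = n) :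
    ∃ g : A.comp.loc.ring →+* B.comp.loc.ring, IsTrunc A.comp.loc B.comp.loc i h' g ∧
      ∀ x, g (A.toLocComp x) = B.toLocComp (f x) := by
  obtain ⟨g₁, hg₁, hc₁⟩ := hf.exists_comp hA
  obtain ⟨g₂, hg₂, hc₂⟩ := hg₁.exists_loc hA.comp h'
  refine ⟨g₂, hg₂, fun x ↦ ?_⟩
  rw [toLocComp_apply, hc₂, hc₁, toLocComp_apply]

theorem IsPrincipal.HL {A : IdealChain.{u} n} (hA : A.IsPrincipal) : A.HL.IsPrincipal := by
  induction n with
  | zero => exact hA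
  | succ n ih => exact ih hA.comp.loc

theorem IsPrincipal.isField {A : IdealChain.{u} 0} (hA : A.IsPrincipal) : IsField A.ring := by
  have hmax : (A.ideal 0).IsMaximal := hA.isMaximal
  rw [hA.bot] at hmax
  have : Nontrivial A.ring := by
    by_contra hn
    rw [not_nontrivial_iff_subsingleton] at hn
    exact hmax.ne_top (Subsingleton.elim _ _)
  exact Ring.isField_iff_maximal_bot.2 hmax

/-- An isomorphism of chains induces an isomorphism of the rings `HL`. -/
theorem IsTrunc.exists_HL_equiv {A : IdealChain.{u} n} {B : IdealChain.{u} n} {h : 0 + n = n}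
    {f : A.ring →+* B.ring} (hf : IsTrunc A B 0 h f) (hA : A.IsPrincipal) :
    ∃ e : A.HL.ring ≃+* B.HL.ring, ∀ x, e (A.toHL x) = B.toHL (f x) := by
  induction n with
  | zero =>
    have hinj : Function.Injective f := (RingHom.injective_iff_ker_eq_bot f).2 (hf.ker.trans hA.bot)
    exact ⟨RingEquiv.ofBijective f ⟨hinj, hf.surjective⟩, fun _ ↦ rfl⟩
  | succ n ih =>
    obtain ⟨g, hg, hc⟩ := hf.exists_comp_loc hA (Nat.zero_add n)
    obtain ⟨e, he⟩ := ih hg hA.comp.loc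
    exact ⟨e, fun x ↦ (he _).trans (congrArg B.comp.loc.toHL (hc x))⟩

end IdealChain

end Truncation

/-! ### The residue field of `HL(A)`, and induction on `i`. -/

section ResidueField

open IsLocalRing

/-- If the completion of `A` at a maximal ideal `m` is a domain whose maximal ideal is principal
and nonzero, then its fraction field is a complete discrete valuation field with residue field
`A / m`. -/
theorem AdicCompletion.exists_isCompleteDiscreteValuation {A : Type u} [CommRing A]
    [IsNoetherianRing A] (m : Ideal A) [m.IsMaximal] [IsDomain (AdicCompletion m A)]
    {x : AdicCompletion m A} (hx : m.map (algebraMap A (AdicCompletion m A)) = Ideal.span {x})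
    (hx0 : x ≠ 0) {K : Type u} [CommRing K] [Algebra (AdicCompletion m A) K]
    [IsFractionRing (AdicCompletion m A) K] :
    ∃ v : Valuation K ℤᵐ⁰, IsCompleteDiscreteValuation v ∧
      ∃ h : ∀ a : A, algebraMap (AdicCompletion m A) K (algebraMap A _ a) ∈ v.integer,
        (∀ y : ValuationResidue v, ∃ a, Ideal.Quotient.mk (v.ltIdeal 1) ⟨_, h a⟩ = y) ∧
        ∀ a, Ideal.Quotient.mk (v.ltIdeal 1) ⟨_, h a⟩ = 0 ↔ a ∈ m := by
  have : IsNoetherianRing (AdicCompletion m A) := isNoetherianRing m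
  have hmax := isMaximal_map_of_le m m le_rfl m.fg_of_isNoetherianRing
  have hcomplete := isAdicComplete_self m m.fg_of_isNoetherianRing
  have : IsLocalRing (AdicCompletion m A) :=
    isLocalRing_of_isAdicComplete_maximal (m.map (algebraMap A (AdicCompletion m A)))
  have hm := eq_maximalIdeal hmax
  rw [hm] at hcomplete hx
  have hnf : ¬ IsField (AdicCompletion m A) := by
    rw [isField_iff_maximalIdeal_eq, hx, Ideal.span_singleton_eq_bot]
    exact hx0
  have hprin : (maximalIdeal (AdicCompletion m A)).IsPrincipal := ⟨x, hx⟩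
  have : IsDiscreteValuationRing (AdicCompletion m A) :=
    ((IsDiscreteValuationRing.TFAE (AdicCompletion m A) hnf).out 0 4).2 hprin
  let _ : Field K := IsFractionRing.toField (AdicCompletion m A)
  let P := IsDiscreteValuationRing.maximalIdeal (AdicCompletion m A)
  have hlt (r : AdicCompletion m A) :
      P.valuation K (algebraMap _ K r) < 1 ↔ r ∈ maximalIdeal (AdicCompletion m A) :=
    P.valuation_lt_one_iff_mem r
  have hmem (a : A) : algebraMap A (AdicCompletion m A) a ∈ maximalIdeal _ ↔ a ∈ m := by
    rw [← Ideal.mem_comap, ← hm]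
    exact ⟨fun ha ↦ by
      rwa [← Ideal.IsMaximal.eq_of_le ‹m.IsMaximal› (Ideal.comap_ne_top _ hmax.ne_top)
        Ideal.le_comap_map] at ha, fun ha ↦ Ideal.mem_map_of_mem _ ha⟩
  refine ⟨P.valuation K, IsDiscreteValuationRing.isCompleteDiscreteValuation (AdicCompletion m A),
    fun a ↦ P.valuation_le_one _, fun y ↦ ?_, fun a ↦ ?_⟩
  · obtain ⟨⟨z, hz⟩, rfl⟩ := Ideal.Quotient.mk_surjective y
    obtain ⟨r, rfl⟩ := IsDiscreteValuationRing.exists_lift_of_le_one hz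
    -- `a` agrees with `r` in `A/m`, so their difference lies in a proper ideal of the local ring
    -- `Â`.
    obtain ⟨a, ha⟩ := Ideal.Quotient.mk_surjective (evalOneₐ m r)
    refine ⟨a, ?_⟩
    rw [Ideal.Quotient.eq, Valuation.mem_ltIdeal_iff]
    change P.valuation K (algebraMap _ K _ - algebraMap _ K r) < 1
    rw [← _root_.map_sub, hlt]
    refine le_maximalIdeal (RingHom.ker_ne_top (evalOneₐ m)) ?_
    rw [RingHom.mem_ker, _root_.map_sub, sub_eq_zero, ← ha]
    rfl
  · rw [Ideal.Quotient.eq_zero_iff_mem, Valuation.mem_ltIdeal_iff, ← hmem]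
    exact hlt _

namespace IdealChain

theorem isFractionRing_of_complMonoid_bot {R F : Type*} [CommRing R] [IsDomain R] [CommRing F]
    [Algebra R F] {p : Ideal R} (hp : p = ⊥) (e : Localization (complMonoid p) ≃+* F)
    (he : ∀ r, e (algebraMap R _ r) = algebraMap R F r) : IsFractionRing R F := by
  subst hp
  have : IsLocalization (nonZeroDivisors R) (Localization (complMonoid (⊥ : Ideal R))) := by
    rw [← Ideal.primeCompl_bot]
    exact isLocalization_atPrime_of_complMonoid ⊥ _
  exact IsLocalization.isLocalization_of_algEquiv (nonZeroDivisors R) (AlgEquiv.ofRingEquiv he)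

variable {n : ℕ}

/-- `HL(A)` is a complete discrete valuation field with residue field `HL(τ₁ A)`. -/
theorem IsTrunc.exists_residue {A : IdealChain.{u} (n + 1)} {B : IdealChain.{u} n}
    {h : 1 + n = n + 1} {f : A.ring →+* B.ring} (hf : IsTrunc A B 1 h f) (hA : A.IsPrincipal)
    {F : Type u} [CommRing F] (e : A.HL.ring ≃+* F) :
    ∃ v : Valuation F ℤᵐ⁰, IsCompleteDiscreteValuation v ∧
      ∃ h : ∀ r, e (A.toHL r) ∈ v.integer, ∃ e' : ValuationResidue v ≃+* B.HL.ring,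
        ∀ r, e' (Ideal.Quotient.mk _ ⟨e (A.toHL r), h r⟩) = B.toHL (f r) := by
  induction n with
  | zero =>
    have := hA.isNoetherianRing
    have : (A.ideal (Fin.last 1)).IsMaximal := hA.isMaximal
    have hC := hA.comp
    have hbot : A.comp.ideal 0 = ⊥ := hC.bot
    have hdom : IsDomain A.comp.ring := by
      have := hC.prime 0
      rw [hbot] at this
      exact IsDomain.of_bot_isPrime _
    obtain ⟨x, hx0, hx⟩ := hC.exists_generator 0
    have hx' : (A.ideal (Fin.last 1)).map A.toComp = Ideal.span {x} :=
      hx.trans ((congrArg (· ⊔ Ideal.span {x}) hbot).trans (bot_sup_eq _))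
    let alg : Algebra A.comp.ring F := (e.toRingHom.comp A.comp.toLoc).toAlgebra
    have : IsFractionRing A.comp.ring F :=
      isFractionRing_of_complMonoid_bot (p := A.comp.ideal (Fin.last 0).castSucc) hbot e
        fun _ ↦ rfl
    obtain ⟨v, hv, h, hsurj, hker⟩ : ∃ v : Valuation F ℤᵐ⁰, IsCompleteDiscreteValuation v ∧
        ∃ h : ∀ a, e (A.toHL a) ∈ v.integer,
          (∀ y : ValuationResidue v, ∃ a, Ideal.Quotient.mk (v.ltIdeal 1) ⟨_, h a⟩ = y) ∧
          ∀ a, Ideal.Quotient.mk (v.ltIdeal 1) ⟨_, h a⟩ = 0 ↔ a ∈ A.ideal (Fin.last 1) :=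
      @AdicCompletion.exists_isCompleteDiscreteValuation A.ring _ _ (A.ideal (Fin.last 1)) _ hdom
        x hx' (fun h0 ↦ hx0 (h0 ▸ zero_mem _)) F _ alg this
    refine ⟨v, hv, h, ?_⟩
    let π : A.ring →+* ValuationResidue v :=
      (Ideal.Quotient.mk (v.ltIdeal 1)).comp
        ((e.toRingHom.comp A.toHL).codRestrict v.integer h)
    -- Both the residue field and the ring of `B` are quotients of `A` by `𝔭₁`.
    have hπ : RingHom.ker π = RingHom.ker f := (Ideal.ext hker).trans hf.ker.symm
    let e₂ := (Ideal.quotEquivOfEq hπ).trans (RingHom.quotientKerEquivOfSurjective hf.surjective)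
    refine ⟨(RingHom.quotientKerEquivOfSurjective (f := π) hsurj).symm.trans e₂, fun r ↦ ?_⟩
    have h1 : (RingHom.quotientKerEquivOfSurjective (f := π) hsurj).symm (π r) =
        Ideal.Quotient.mk _ r := by
      rw [RingEquiv.symm_apply_eq]
      rfl
    exact congrArg e₂ h1
  | succ n ih =>
    -- `HL` of a chain is by definition `HL` of its `loc comp`, so the same `e` serves the shorter
    -- chain.
    obtain ⟨g, hg, hc⟩ := hf.exists_comp_loc hA (Nat.add_comm 1 n)
    obtain ⟨v, hv, h, e', he'⟩ := ih hg hA.comp.loc e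
    exact ⟨v, hv, fun r ↦ h (A.toLocComp r), e',
      fun r ↦ (he' (A.toLocComp r)).trans (congrArg B.comp.loc.toHL (hc r))⟩

/-- The truncation `τᵢ₊₁ A` is a truncation of `τ₁ A`. -/
theorem IsTrunc.exists_factor {m i : ℕ} {A : IdealChain.{u} (n + 1)} {B : IdealChain.{u} m}
    {h : i + 1 + m = n + 1} {f : A.ring →+* B.ring} (hf : IsTrunc A B (i + 1) h f)
    (hA : A.IsPrincipal) (h₁ : 1 + n = n + 1) (h' : i + m = n) :
    ∃ g : (A.trunc 1 n h₁).ring →+* B.ring, IsTrunc (A.trunc 1 n h₁) B i h' g ∧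
      ∀ x, g (A.toTrunc 1 n h₁ x) = f x := by
  have hle : A.ideal ⟨1, by omega⟩ ≤ RingHom.ker f :=
    hf.ker ▸ hA.monotone (Fin.mk_le_mk.2 (by omega))
  obtain ⟨g, hg⟩ : ∃ g : (A.trunc 1 n h₁).ring →+* B.ring, g.comp (A.toTrunc 1 n h₁) = f :=
    ⟨Ideal.Quotient.lift _ f hle, Ideal.Quotient.lift_comp_mk _ f hle⟩
  have hmap (j : ℕ) (hj : j < n + 1) : (A.trunc 1 n h₁).ideal ⟨j, hj⟩ =
      (A.ideal ⟨j + 1, by omega⟩).map (A.toTrunc 1 n h₁) :=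
    congrArg (fun k ↦ (A.ideal k).map (A.toTrunc 1 n h₁)) (Fin.ext (Nat.add_comm 1 j))
  have hsurj : Function.Surjective (A.toTrunc 1 n h₁) := Ideal.Quotient.mk_surjective
  refine ⟨g, ⟨?_, ?_, fun j ↦ ?_⟩, fun x ↦ congr($hg x)⟩
  · refine Function.Surjective.of_comp (g := A.toTrunc 1 n h₁) ?_
    rw [← RingHom.coe_comp, hg]
    exact hf.surjective
  · rw [hmap, ← hf.ker, ← hg, ← RingHom.comap_ker, Ideal.map_comap_of_surjective _ hsurj]
  · rw [hmap, Ideal.map_map, hg, ← hf.map_ideal]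
    exact congrArg (fun k ↦ (A.ideal k).map f) (Fin.ext (by simp only; omega))

/-- Induction on `i`, peeling off `τ₁`. `F` is only isomorphic to `HL(A)`, because a residue ring is
only isomorphic to `HL(τ₁ A)`; the map `q` keeps the source `R` fixed while the chain changes. -/
theorem IsTrunc.isResidueField {R : Type u} [CommRing R] {m i : ℕ} {A : IdealChain.{u} n}
    {B : IdealChain.{u} m} {h : i + m = n} {f : A.ring →+* B.ring} (hf : IsTrunc A B i h f)
    (hA : A.IsPrincipal) {F : Type u} [CommRing F] (e : A.HL.ring ≃+* F) (q : R →+* A.ring)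
    (φ : R →+* F) (hφ : ∀ r, φ r = e (A.toHL (q r))) (g : R →+* B.HL.ring)
    (hg : ∀ r, g r = B.toHL (f (q r))) :
    IsResidueField g i φ := by
  induction i generalizing n F with
  | zero =>
    obtain rfl : m = n := by omega
    obtain ⟨e', he'⟩ := hf.exists_HL_equiv hA
    refine ⟨e.symm.toMulEquiv.isField hA.HL.isField, e.symm.trans e', fun r ↦ ?_⟩
    rw [hφ, hg, ← he']
    simp
  | succ i ih =>
    obtain ⟨n, rfl⟩ : ∃ k, n = k + 1 := ⟨i + m, by omega⟩
    have h₁ : 1 + n = n + 1 := Nat.add_comm 1 n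
    have hC := A.isTrunc_toTrunc 1 n h₁
    obtain ⟨v, hv, hint, e', he'⟩ := hC.exists_residue hA e
    obtain ⟨f', hf', hff'⟩ := hf.exists_factor hA h₁ (by omega)
    refine ⟨v, hv, fun r ↦ hφ r ▸ hint (q r), ?_⟩
    refine ih hf' (hC.isPrincipal hA) e'.symm ((A.toTrunc 1 n h₁).comp q) _ (fun r ↦ ?_)
      (fun r ↦ ?_)
    · rw [RingEquiv.eq_symm_apply]
      refine Eq.trans (congrArg e' ?_) (he' (q r))
      exact congrArg (Ideal.Quotient.mk (v.ltIdeal 1)) (Subtype.ext (hφ r))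
    · rw [hg, ← hff']
      rfl

end IdealChain

end ResidueField

theorem mainTheorem6 {n : ℕ} (A : IdealChain.{u} n) (hA : A.IsRegular)
    (i m : ℕ) (h : i + m = n) :
    IsResidueField ((A.trunc i m h).toHL.comp (A.toTrunc i m h)) i A.toHL :=
  (A.isTrunc_toTrunc i m h).isResidueField hA.isPrincipal (RingEquiv.refl _) (RingHom.id _) _
    (fun _ ↦ rfl) _ (fun _ ↦ rfl)
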